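/- Let $n\ge 0$ and let $G$ be a set of maps $\mathbb R^n\to\mathbb R^n$ such that: (A1) $G$ is closed under composition; (A2) every $\phi\in G$ is of class $C^1$ and $\phi-\mathrm{id}$ has compact support; (A3) $f\circ\phi\circ f^{-1}\in G$ for every $\phi\in G$ and every map $f(x)=x_1+\varepsilon(x-x_0)$ with $x_0,x_1\in\mathbb R^n$, $\varepsilon>0$. For $E\subset\mathbb R^n$ let $G(E)$ be the set of $\phi\in G$ such that $\operatorname{supp}(\phi-\mathrm{id})$ is a compact subset of $E$. Let $J(G)=\{\nabla\phi(x_0):\phi\in G\}$, a set of $n\times n$ matrices which does not depend on $x_0\in\mathbb R^n$. Let $\Omega\subset\mathbb R^n$ be open and bounded, let $W:\mathbb R^n\times\mathbb R^n\times J(G)\to\mathbb R$ be continuous, and put $I(u;\Omega)=\int_\Omega W(x,u(x),\nabla u(x))\,dx$ for $u\in G$. Say that $W$ is $G$ left lower invariant at $(x_0,y_0,F)\in\mathbb R^n\times\mathbb R^n\times J(G)$ if for every bounded open $E\subset\mathbb R^n$ and every $\phi\in G(E)$ $$\int_E W(x_0,y_0,F\,\nabla\phi(y))\,dy\ \ge\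 |E|\,W(x_0,y_0,F).$$ Suppose that for every $\psi\in G$ and every sequence $(\phi_h)_{h\in\mathbb N}$ in $G(\Omega)$ which converges to $\mathrm{id}$ weak* in $W^{1,\infty}(\Omega,\mathbb R^n)$ (that is, $\phi_h\to\mathrm{id}$ and $\nabla\phi_h\to\nabla\,\mathrm{id}$ weak* in $L^\infty(\Omega)$, as the dual of $L^1(\Omega)$) one has $$I(\psi;\Omega)\ \le\ \liminf_{h\to\infty} I(\psi\circ\phi_h;\Omega),$$ the lower limit being taken in $[-\infty,+\infty]$. Then $W$ is $G$ left lower invariant at $(x,\psi(x),\nabla\psi(x))$ for every $\psi\in G$ and every $x\in\Omega$. If moreover $W=W(x,F)$ does not depend on its second variable, then $W$ is $G$ left lower invariant at every pair $(x,F)\in\Omega\times J(G)$ (that is, at $(x,y,F)$ for every $y\in\mathbb R^n$). -/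

import Mathlib

open MeasureTheory Filter Topology Set

namespace GroupInvariance

/-- Euclidean space `ℝⁿ`. -/
abbrev Rn (n : ℕ) := EuclideanSpace ℝ (Fin n)

/-- `n × n` real matrices, seen as linear maps of `ℝⁿ`; the matrix product is composition `∘L`.
The gradient `∇φ(x)` of a `C¹` map is `fderiv ℝ φ x`. -/
abbrev Mat (n : ℕ) := Rn n →L[ℝ] Rn n

variable {n : ℕ}

/-- The homothety-translation `x ↦ x₁ + ε (x - x₀)`. -/
def homothety (x₀ x₁ : Rn n) (ε : ℝ) : Rn n → Rn n := fun x => x₁ + ε • (x - x₀)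

/-- The standing axioms on a set `G` of maps `ℝⁿ → ℝⁿ`.
Note that a `C¹` map is automatically in `W^{1,∞}_loc`, so that `C¹ ∩ W^{1,∞}_id` consists
of the `C¹` maps `φ` for which `φ - id` has compact support. -/
structure Admissible (G : Set (Rn n → Rn n)) : Prop where
  /-- `G` is a semigroup under composition. -/
  comp_mem : ∀ φ ∈ G, ∀ ψ ∈ G, φ ∘ ψ ∈ G
  /-- The elements of `G` are of class `C¹`. -/
  contDiff : ∀ φ ∈ G, ContDiff ℝ 1 φ
  /-- The elements of `G` agree with the identity outside a compact set. -/
  hasCompactSupport : ∀ φ ∈ G, HasCompactSupport (fun x => φ x - x)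
  /-- `G` is stable under `φ ↦ f ∘ φ ∘ f⁻¹` for every homothety-translation `f` of ratio `ε > 0`;
  the inverse of `x ↦ x₁ + ε (x - x₀)` is `y ↦ x₀ + ε⁻¹ (y - x₁)`. -/
  conj_mem : ∀ φ ∈ G, ∀ (x₀ x₁ : Rn n) (ε : ℝ), 0 < ε →
    homothety x₀ x₁ ε ∘ φ ∘ homothety x₁ x₀ ε⁻¹ ∈ G

/-- `G(E)`: the elements `φ` of `G` such that the support of `φ - id` is compactly included
in `E`. -/
def supportedIn (G : Set (Rn n → Rn n)) (E : Set (Rn n)) : Set (Rn n → Rn n) :=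
  {φ ∈ G | HasCompactSupport (fun x => φ x - x) ∧ tsupport (fun x => φ x - x) ⊆ E}

/-- `J¹(x₀, G)`: the first order jet of `G` at `x₀`. -/
def jetAt (x₀ : Rn n) (G : Set (Rn n → Rn n)) : Set (Mat n) :=
  {F | ∃ φ ∈ G, fderiv ℝ φ x₀ = F}

/-- `J(G)`, the common value of the jets `J¹(x₀, G)`; see `jetAt_eq_jet`. -/
def jet (G : Set (Rn n → Rn n)) : Set (Mat n) := jetAt 0 G

theorem Admissible.jetAt_subset {G : Set (Rn n → Rn n)} (hG : Admissible G) (x y : Rn n) :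
    jetAt x G ⊆ jetAt y G := by
  rintro F ⟨φ, hφ, rfl⟩
  refine ⟨_, hG.conj_mem φ hφ x y 1 one_pos, ?_⟩
  have h1 : HasFDerivAt (homothety y x (1 : ℝ)⁻¹) (ContinuousLinearMap.id ℝ (Rn n)) y := by
    have : homothety y x (1 : ℝ)⁻¹ = fun z => x + (z - y) := by
      funext z; simp [homothety]
    rw [this]
    exact ((hasFDerivAt_id y).sub_const y).const_add x
  have hx : homothety y x (1 : ℝ)⁻¹ y = x := by simp [homothety]
  have h2 : HasFDerivAt φ (fderiv ℝ φ x) (homothety y x (1 : ℝ)⁻¹ y) := by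
    rw [hx]
    exact ((hG.contDiff φ hφ).differentiable one_ne_zero x).hasFDerivAt
  have h3 : ∀ z, HasFDerivAt (homothety x y (1 : ℝ)) (ContinuousLinearMap.id ℝ (Rn n)) z := by
    intro z
    have : homothety x y (1 : ℝ) = fun z => y + (z - x) := by
      funext z; simp [homothety]
    rw [this]
    exact ((hasFDerivAt_id z).sub_const x).const_add y
  have h4 := (h3 _).comp y (h2.comp y h1)
  exact h4.fderiv.trans (by ext; simp)

/-- The first order jet does not depend on the point. -/
theorem Admissible.jetAt_eq_jet {G : Set (Rn n → Rn n)} (hG : Admissible G) (x : Rn n) :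
    jetAt x G = jet G :=
  (hG.jetAt_subset x 0).antisymm (hG.jetAt_subset 0 x)

/-- `I(u; Ω) = ∫_Ω W(x, u(x), ∇u(x)) dx`. -/
noncomputable def energy (W : Rn n → Rn n → Mat n → ℝ) (Ω : Set (Rn n)) (u : Rn n → Rn n) : ℝ :=
  ∫ x in Ω, W x (u x) (fderiv ℝ u x)

/-- Weak* convergence `φ_h → φ` in `W^{1,∞}(Ω, ℝⁿ)`, for `C¹` maps: the maps and their gradients
converge weak* in `L^∞(Ω)`, that is, when tested against every function in `L¹(Ω)`. -/
def WeakStarTendsto (Ω : Set (Rn n)) (φs : ℕ → Rn n → Rn n) (φ : Rn n → Rn n) : Prop :=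
  ∀ g : Rn n → ℝ, IntegrableOn g Ω →
    Tendsto (fun h => ∫ x in Ω, g x • φs h x) atTop (𝓝 (∫ x in Ω, g x • φ x)) ∧
    Tendsto (fun h => ∫ x in Ω, g x • fderiv ℝ (φs h) x) atTop
      (𝓝 (∫ x in Ω, g x • fderiv ℝ φ x))

/-- `W` is `G` left lower invariant at `(x₀, y₀, F)`: for every bounded open set `E` and every
`φ ∈ G(E)` one has `∫_E W(x₀, y₀, F ∇φ(y)) dy ≥ |E| W(x₀, y₀, F)`. -/
def LeftLowerInvariantAt (G : Set (Rn n → Rn n)) (W : Rn n → Rn n → Mat n → ℝ)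
    (x₀ y₀ : Rn n) (F : Mat n) : Prop :=
  ∀ E : Set (Rn n), IsOpen E → Bornology.IsBounded E → ∀ φ ∈ supportedIn G E,
    volume.real E * W x₀ y₀ F ≤ ∫ y in E, W x₀ y₀ (F ∘L fderiv ℝ φ y)

end GroupInvariance

/-!
Fix `ψ ∈ G`, `x₀ ∈ Ω`, write `F = ∇ψ(x₀)`, and let `φ ∈ G(E)`. Left lower invariance at
`(x₀, ψ(x₀), F)` says that the excess `W(x₀, ψ(x₀), F ∇φ(y)) - W(x₀, ψ(x₀), F)`, which vanishes
off the support of `φ - id`, has a nonnegative integral over `ℝⁿ`.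

Rescaled copies of `φ` are placed in disjoint balls around the points of a lattice of spacing
`δ / m` in a small ball about `x₀`. If the balls are large enough for `φ` to map them into
themselves, the copies superpose: their composition `Φ` lies in `G(Ω)` and equals the respective
copy on each ball
(`Admissible.exists_superposition`). As `m → ∞` the maps `Φ` converge uniformly to the identity with
bounded gradients, hence weak* in `W^{1,∞}`, by integration by parts and density of smooth functions
in `L¹` (`weakStarTendsto_id`). The `m ^ n` copies have scale proportional to `δ / m`, so their
total volume does not depend on `m`. By continuity of `W` and `∇ψ`, with all balls close to `x₀`, the
energy `I(ψ ∘ Φ; Ω)` exceeds `I(ψ; Ω)` by at most `κ (∫ excess + η |B|)` with a fixed `κ > 0`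
and `η` as small as desired (`Admissible.energy_comp_le`, `Admissible.exists_seq_superposition`).
Since the error is carried by the copies alone, they need not fill the region, and no tiling by cubes is
involved. Lower semicontinuity then gives `0 ≤ ∫ excess + η |B|` for every `η > 0`.

If `W` does not depend on its second variable, every `F ∈ J(G)` is `∇ψ(x)` for some `ψ ∈ G`, and the
value `ψ(x)` is immaterial.
-/

namespace GroupInvariance

variable {n : ℕ}

/-! ### Weak* convergence to the identity -/

section WeakStar

variable {E F : Type*} [NormedAddCommGroup E] [NormedSpace ℝ E] [FiniteDimensional ℝ E]
  [MeasureSpace E] [BorelSpace E] [NormedAddCommGroup F] [NormedSpace ℝ F]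
  [(volume : Measure E).IsAddHaarMeasure]

/-- The first order derivative of `v` tested against a smooth function is controlled by the uniform
norm of `v`, through an integration by parts in each direction. -/
theorem norm_integral_smul_fderiv_le {v : E → F} (hv : ContDiff ℝ 1 v)
    (hvc : HasCompactSupport v) {a : ℝ} (ha : ∀ x, ‖v x‖ ≤ a) {g : E → ℝ}
    (hg : ContDiff ℝ 1 g) (hgc : HasCompactSupport g) :
    ‖∫ x, g x • fderiv ℝ v x‖ ≤ (∫ x, ‖fderiv ℝ g x‖) * a := by
  have hg' : Continuous (fderiv ℝ g) := hg.continuous_fderiv one_ne_zero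
  have hv' : Continuous (fderiv ℝ v) := hv.continuous_fderiv one_ne_zero
  have ha0 : 0 ≤ a := (norm_nonneg _).trans (ha 0)
  have hint : Integrable (fun x => ‖fderiv ℝ g x‖) :=
    (hg'.integrable_of_hasCompactSupport (hgc.fderiv ℝ)).norm
  refine ContinuousLinearMap.opNorm_le_bound _
    (mul_nonneg (integral_nonneg fun _ => norm_nonneg _) ha0) fun w => ?_
  have hi : Integrable (fun x => g x • fderiv ℝ v x) :=
    (hg.continuous.smul hv').integrable_of_hasCompactSupport hgc.smul_right
  rw [ContinuousLinearMap.integral_apply hi]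
  simp only [smul_apply]
  have hgw : Continuous fun x => fderiv ℝ g x w := hg'.clm_apply continuous_const
  have hvw : Continuous fun x => fderiv ℝ v x w := hv'.clm_apply continuous_const
  have hi1 : Integrable (fun x => fderiv ℝ g x w • v x) :=
    (hgw.smul hv.continuous).integrable_of_hasCompactSupport
      (HasCompactSupport.smul_left (f := fun x => fderiv ℝ g x w) hvc)
  have hi2 : Integrable (fun x => g x • fderiv ℝ v x w) :=
    (hg.continuous.smul hvw).integrable_of_hasCompactSupport
      (HasCompactSupport.smul_right (f' := fun x => fderiv ℝ v x w) hgc)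
  have hi3 : Integrable (fun x => g x • v x) :=
    (hg.continuous.smul hv.continuous).integrable_of_hasCompactSupport hgc.smul_right
  rw [integral_smul_fderiv_eq_neg_fderiv_smul_of_integrable hi1 hi2 hi3
    (fun x _ => hg.differentiable one_ne_zero x) (fun x _ => hv.differentiable one_ne_zero x),
    norm_neg]
  calc ‖∫ x, fderiv ℝ g x w • v x‖ ≤ ∫ x, ‖fderiv ℝ g x‖ * (a * ‖w‖) := by
        refine norm_integral_le_of_norm_le (hint.mul_const _) (.of_forall fun x => ?_)
        rw [norm_smul, mul_comm a, ← mul_assoc]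
        gcongr
        · exact (fderiv ℝ g x).le_opNorm w
        · exact ha x
    _ = _ := by rw [integral_mul_const]; ring

/-- Gradients of uniformly Lipschitz maps which converge uniformly to zero converge weak* to zero:
integrate by parts against a smooth function, and approximate a general test function by smooth
ones in `L¹`. -/
theorem tendsto_integral_smul_fderiv {v : ℕ → E → F} (hv : ∀ h, ContDiff ℝ 1 (v h))
    (hvc : ∀ h, HasCompactSupport (v h)) {a : ℕ → ℝ} (ha : ∀ h x, ‖v h x‖ ≤ a h)
    (ha0 : Tendsto a atTop (𝓝 0)) {C : ℝ} (hC : ∀ h x, ‖fderiv ℝ (v h) x‖ ≤ C)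
    {g : E → ℝ} (hg : Integrable g) :
    Tendsto (fun h => ∫ x, g x • fderiv ℝ (v h) x) atTop (𝓝 0) := by
  have hC0 : 0 ≤ C := (norm_nonneg _).trans (hC 0 0)
  rw [Metric.tendsto_atTop']
  intro η hη
  obtain ⟨χ, hχc, hχ, hgχ⟩ := (memLp_one_iff_integrable.2 hg).exist_eLpNorm_sub_le
    ENNReal.one_ne_top le_rfl (show 0 < η / (2 * (C + 1)) by positivity)
  have hχ1 : ContDiff ℝ 1 χ := hχ.of_le (by exact_mod_cast le_top)
  have hχi : Integrable χ := hχ.continuous.integrable_of_hasCompactSupport hχc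
  have hdiff : ∫ x, ‖g x - χ x‖ ≤ η / (2 * (C + 1)) := by
    rw [eLpNorm_one_eq_lintegral_enorm] at hgχ
    have := integral_norm_eq_lintegral_enorm (hg.sub hχi).aestronglyMeasurable
    simp only [Pi.sub_apply] at this hgχ
    rw [this]
    exact ENNReal.toReal_le_of_le_ofReal (by positivity) hgχ
  have hlim : Tendsto (fun h => (∫ x, ‖fderiv ℝ χ x‖) * a h) atTop (𝓝 0) := by
    simpa using ha0.const_mul (∫ x, ‖fderiv ℝ χ x‖)
  obtain ⟨N, hN⟩ := (hlim.eventually_lt_const (half_pos hη)).exists_forall_of_atTop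
  refine ⟨N, fun h hh => ?_⟩
  have hv' : Continuous (fderiv ℝ (v h)) := (hv h).continuous_fderiv one_ne_zero
  have hi1 : Integrable (fun x => (g x - χ x) • fderiv ℝ (v h) x) :=
    (hg.sub hχi).smul_bdd C hv'.aestronglyMeasurable (.of_forall (hC h))
  have hi2 : Integrable (fun x => χ x • fderiv ℝ (v h) x) :=
    hχi.smul_bdd C hv'.aestronglyMeasurable (.of_forall (hC h))
  have hsplit : ∫ x, g x • fderiv ℝ (v h) x =
      (∫ x, (g x - χ x) • fderiv ℝ (v h) x) + ∫ x, χ x • fderiv ℝ (v h) x := by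
    rw [← integral_add hi1 hi2]
    refine integral_congr_ae (.of_forall fun x => ?_)
    dsimp only
    rw [← add_smul, sub_add_cancel]
  have h1 : ‖∫ x, (g x - χ x) • fderiv ℝ (v h) x‖ ≤ η / 2 := by
    calc _ ≤ ∫ x, ‖g x - χ x‖ * C := by
          refine norm_integral_le_of_norm_le ((hg.sub hχi).norm.mul_const _)
            (.of_forall fun x => ?_)
          rw [norm_smul]
          gcongr
          exact hC h x
      _ = (∫ x, ‖g x - χ x‖) * C := integral_mul_const _ _
      _ ≤ η / (2 * (C + 1)) * (C + 1) := by gcongr; linarith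
      _ = η / 2 := by field_simp
  have h2 := norm_integral_smul_fderiv_le (hv h) (hvc h) (ha h) hχ1 hχc
  rw [dist_zero_right, hsplit]
  linarith [norm_add_le (∫ x, (g x - χ x) • fderiv ℝ (v h) x) (∫ x, χ x • fderiv ℝ (v h) x),
    hN h hh.le]

end WeakStar

/-- `C¹` maps which converge uniformly to the identity, with uniformly bounded gradients, converge
to it weak* in `W^{1,∞}`. -/
theorem weakStarTendsto_id {Ω : Set (Rn n)} (hΩ : IsOpen Ω) (hΩb : Bornology.IsBounded Ω)
    {φ : ℕ → Rn n → Rn n} (hφ : ∀ h, ContDiff ℝ 1 (φ h))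
    (hφc : ∀ h, HasCompactSupport fun x => φ h x - x) {a : ℕ → ℝ}
    (ha : ∀ h x, ‖φ h x - x‖ ≤ a h) (ha0 : Tendsto a atTop (𝓝 0)) {C : ℝ}
    (hC : ∀ h x, ‖fderiv ℝ (φ h) x - ContinuousLinearMap.id ℝ (Rn n)‖ ≤ C) :
    WeakStarTendsto Ω φ id := by
  intro g hg
  constructor
  · obtain ⟨A, hA⟩ := ha0.bddAbove_range
    obtain ⟨r, hr⟩ := hΩb.exists_norm_le
    refine tendsto_integral_of_dominated_convergence (fun x => ‖g x‖ * (A + r))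
      (fun h => hg.aestronglyMeasurable.smul (hφ h).continuous.aestronglyMeasurable)
      (hg.norm.mul_const _) (fun h => ?_) (.of_forall fun x => ?_)
    · filter_upwards [ae_restrict_mem hΩ.measurableSet] with x hx
      rw [norm_smul]
      gcongr
      calc ‖φ h x‖ = ‖(φ h x - x) + x‖ := by rw [sub_add_cancel]
        _ ≤ A + r := (norm_add_le _ _).trans
          (add_le_add ((ha h x).trans (hA (mem_range_self h))) (hr x hx))
    · refine Tendsto.const_smul ?_ _
      rw [tendsto_iff_norm_sub_tendsto_zero]
      exact squeeze_zero (fun _ => norm_nonneg _) (fun h => ha h x) ha0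
  · have hv : ∀ h x, fderiv ℝ (fun x => φ h x - x) x =
        fderiv ℝ (φ h) x - ContinuousLinearMap.id ℝ (Rn n) := fun h x =>
      (((hφ h).differentiable one_ne_zero x).hasFDerivAt.sub (hasFDerivAt_id x)).fderiv
    have key := tendsto_integral_smul_fderiv (v := fun h x => φ h x - x)
      (fun h => (hφ h).sub contDiff_id) hφc ha ha0 (C := C)
      (fun h x => by rw [hv]; exact hC h x) (hg.integrable_indicator hΩ.measurableSet)
    have key2 := key.add_const (∫ x in Ω, g x • fderiv ℝ (id : Rn n → Rn n) x)
    rw [zero_add] at key2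
    refine key2.congr fun h => ?_
    have hc : Continuous (fderiv ℝ (φ h)) := (hφ h).continuous_fderiv one_ne_zero
    have : ∀ x, Ω.indicator g x • fderiv ℝ (fun x => φ h x - x) x =
        Ω.indicator (fun x => g x • (fderiv ℝ (φ h) x - ContinuousLinearMap.id ℝ (Rn n))) x := by
      intro x
      rw [hv]
      by_cases hx : x ∈ Ω 
      · simp only [hx, indicator_of_mem]
      · simp only [hx, not_false_eq_true, indicator_of_notMem]
        exact zero_smul ℝ (_ : Mat n)
    simp only [this, fderiv_id]
    rw [integral_indicator hΩ.measurableSet, ← integral_add]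
    · refine integral_congr_ae (.of_forall fun x => ?_)
      dsimp only
      exact (smul_add _ _ _).symm.trans (by rw [sub_add_cancel])
    · exact hg.smul_bdd C (hc.sub continuous_const).aestronglyMeasurable (.of_forall (hC h))
    · exact hg.smul_const _

/-! ### Superposition of rescaled maps -/

/-- Elements of `G` which act on pairwise disjoint sets, each of them mapped into itself, can be
superposed within the semigroup. The invariance of the sets is what makes the order of composition
irrelevant, since elements of `G` need not be injective. -/
theorem Admissible.exists_superposition {G : Set (Rn n → Rn n)} (hG : Admissible G) {ι : Type*}
    (B : ι → Set (Rn n)) (hB : Pairwise (Function.onFun Disjoint B)) (f : ι → Rn n → Rn n)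
    (hf : ∀ i, f i ∈ G) (hmaps : ∀ i, MapsTo (f i) (B i) (B i))
    (hid : ∀ i, ∀ x ∉ B i, f i x = x) {s : Finset ι} (hs : s.Nonempty) :
    ∃ Φ ∈ G, (∀ i ∈ s, EqOn Φ (f i) (B i)) ∧ ∀ x, (∀ i ∈ s, x ∉ B i) → Φ x = x := by
  classical
  -- No identity map is at hand in `G`, so the induction starts from a single element.
  induction hs using Finset.Nonempty.cons_induction with
  | singleton i => exact ⟨f i, hf i, by simp [EqOn], by simpa using hid i⟩
  | cons i s his _ ih =>
    obtain ⟨Φ, hΦ, hΦs, hΦid⟩ := ih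
    refine ⟨f i ∘ Φ, hG.comp_mem _ (hf i) _ hΦ, fun j hj x hx => ?_, fun x hx => ?_⟩
    · have hne : ∀ k, k ≠ j → x ∉ B k := fun k hk hxk => (hB hk).notMem_of_mem_left hxk hx
      rcases Finset.mem_cons.1 hj with rfl | hj
      · rw [Function.comp_apply, hΦid x fun k hk => hne k fun h => his (h ▸ hk)]
      · have hij : i ≠ j := fun h => his (h ▸ hj)
        rw [Function.comp_apply, hΦs j hj hx]
        exact hid i _ ((hB hij).notMem_of_mem_right (hmaps j hx))
    · rw [Finset.forall_mem_cons] at hx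
      rw [Function.comp_apply, hΦid x hx.2, hid i x hx.1]

/-- An element of `G` is the identity outside a ball, and maps some larger concentric ball into
itself. -/
theorem Admissible.exists_radius {G : Set (Rn n → Rn n)} (hG : Admissible G) {φ : Rn n → Rn n}
    (hφ : φ ∈ G) : ∃ r R : ℝ, 0 < r ∧ r < R ∧ (∀ x, r < ‖x‖ → φ x = x) ∧
      MapsTo φ (Metric.ball 0 R) (Metric.ball 0 R) := by
  obtain ⟨r, hr0, hr⟩ := (hG.hasCompactSupport φ hφ).isCompact.isBounded.exists_pos_norm_le
  obtain ⟨C, hC⟩ := (isCompact_closedBall (0 : Rn n) r).exists_bound_of_continuousOn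
    (hG.contDiff φ hφ).continuous.continuousOn
  have hid : ∀ x, r < ‖x‖ → φ x = x := fun x hx =>
    sub_eq_zero.1 (image_eq_zero_of_notMem_tsupport
      (f := fun x => φ x - x) fun h => hx.not_ge (hr x h))
  refine ⟨r, max r C + 1, hr0, (le_max_left _ _).trans_lt (lt_add_one _), hid, fun x hx => ?_⟩
  rw [mem_ball_zero_iff] at hx ⊢
  rcases le_or_gt ‖x‖ r with h | h
  · exact (hC x (mem_closedBall_zero_iff.2 h)).trans_lt
      ((le_max_right _ _).trans_lt (lt_add_one _))
  · rwa [hid x h]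

/-- The copy of `φ` rescaled by the factor `ε` and centred at `p`. -/
noncomputable def rescale (φ : Rn n → Rn n) (p : Rn n) (ε : ℝ) : Rn n → Rn n :=
  fun x => p + ε • φ (ε⁻¹ • (x - p))

theorem Admissible.rescale_mem {G : Set (Rn n → Rn n)} (hG : Admissible G) {φ : Rn n → Rn n}
    (hφ : φ ∈ G) (p : Rn n) {ε : ℝ} (hε : 0 < ε) : rescale φ p ε ∈ G := by
  convert hG.conj_mem φ hφ 0 p ε hε using 1
  funext x
  simp [homothety, rescale]

theorem fderiv_rescale {φ : Rn n → Rn n} (hφ : Differentiable ℝ φ) (p : Rn n) {ε : ℝ}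
    (hε : 0 < ε) (x : Rn n) : fderiv ℝ (rescale φ p ε) x = fderiv ℝ φ (ε⁻¹ • (x - p)) := by
  have h1 : HasFDerivAt (fun x => ε⁻¹ • (x - p)) (ε⁻¹ • ContinuousLinearMap.id ℝ (Rn n)) x :=
    ((hasFDerivAt_id x).sub_const p).const_smul ε⁻¹
  have h2 := ((((hφ _).hasFDerivAt.comp x h1).const_smul ε).const_add p).fderiv
  refine h2.trans ?_
  ext1 v
  simp [smul_smul, hε.ne']

theorem norm_inv_smul_sub_lt_iff {p x : Rn n} {ε R : ℝ} (hε : 0 < ε) :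
    ‖ε⁻¹ • (x - p)‖ < R ↔ x ∈ Metric.ball p (ε * R) := by
  rw [norm_smul, norm_inv, Real.norm_of_nonneg hε.le, inv_mul_lt_iff₀ hε, mem_ball_iff_norm]

theorem mapsTo_rescale {φ : Rn n → Rn n} {R ε : ℝ} (hε : 0 < ε)
    (hφ : MapsTo φ (Metric.ball 0 R) (Metric.ball 0 R)) (p : Rn n) :
    MapsTo (rescale φ p ε) (Metric.ball p (ε * R)) (Metric.ball p (ε * R)) := by
  intro x hx
  rw [← norm_inv_smul_sub_lt_iff hε] at hx ⊢
  rw [rescale, add_sub_cancel_left, smul_smul, inv_mul_cancel₀ hε.ne', one_smul]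
  simpa using hφ (mem_ball_zero_iff.2 hx)

theorem rescale_eq_self {φ : Rn n → Rn n} {r ε : ℝ} (hε : 0 < ε)
    (hφ : ∀ x, r < ‖x‖ → φ x = x) {p x : Rn n} (hx : x ∉ Metric.closedBall p (ε * r)) :
    rescale φ p ε x = x := by
  have : r < ‖ε⁻¹ • (x - p)‖ := by
    rwa [norm_smul, norm_inv, Real.norm_of_nonneg hε.le, lt_inv_mul_iff₀ hε, ← dist_eq_norm,
      ← not_le]
  rw [rescale, hφ _ this, smul_smul, mul_inv_cancel₀ hε.ne', one_smul, add_sub_cancel]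

/-- `Φ` is a superposition of copies of `φ` of scale `ε` supported in the balls of radius `ε * R`
with centres `p i`: near each point of such a ball it coincides with the copy centred there, and it
is the identity near every point outside the balls. -/
def IsSuperposition {ι : Type*} (φ : Rn n → Rn n) (p : ι → Rn n) (ε R : ℝ)
    (Φ : Rn n → Rn n) : Prop :=
  ∀ x, (∃ i, x ∈ Metric.ball (p i) (ε * R) ∧ Φ =ᶠ[𝓝 x] rescale φ (p i) ε) ∨
    (∀ i, x ∉ Metric.ball (p i) (ε * R)) ∧ Φ =ᶠ[𝓝 x] id

theorem Admissible.exists_isSuperposition {G : Set (Rn n → Rn n)} (hG : Admissible G)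
    {φ : Rn n → Rn n} (hφ : φ ∈ G) {r R ε : ℝ} (hrR : r < R) (hid : ∀ x, r < ‖x‖ → φ x = x)
    (hmaps : MapsTo φ (Metric.ball 0 R) (Metric.ball 0 R)) (hε : 0 < ε)
    {ι : Type*} [Finite ι] [Nonempty ι] {p : ι → Rn n}
    (hp : Pairwise (Function.onFun Disjoint fun i => Metric.ball (p i) (ε * R))) :
    ∃ Φ ∈ G, IsSuperposition φ p ε R Φ := by
  have := Fintype.ofFinite ι
  have hsub : ∀ i, Metric.closedBall (p i) (ε * r) ⊆ Metric.ball (p i) (ε * R) := fun i =>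
    Metric.closedBall_subset_ball (by gcongr)
  obtain ⟨Φ, hΦ, hΦB, hΦid⟩ := hG.exists_superposition
    (fun i => Metric.ball (p i) (ε * R)) hp (fun i => rescale φ (p i) ε)
    (fun i => hG.rescale_mem hφ (p i) hε) (fun i => mapsTo_rescale hε hmaps (p i))
    (fun i x hx => rescale_eq_self hε hid fun h => hx (hsub i h)) Finset.univ_nonempty
  refine ⟨Φ, hΦ, fun x => ?_⟩
  by_cases hx : ∃ i, x ∈ Metric.ball (p i) (ε * R)
  · obtain ⟨i, hi⟩ := hx
    exact .inl ⟨i, hi, (hΦB i (Finset.mem_univ i)).eventuallyEq_of_mem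
      (Metric.isOpen_ball.mem_nhds hi)⟩
  · rw [not_exists] at hx
    refine .inr ⟨hx, ?_⟩
    have hev : ∀ᶠ y in 𝓝 x, ∀ i, y ∉ Metric.closedBall (p i) (ε * r) :=
      eventually_all.2 fun i =>
        Metric.isClosed_closedBall.isOpen_compl.mem_nhds fun h => hx i (hsub i h)
    filter_upwards [hev] with y hy
    by_cases hyB : ∃ i, y ∈ Metric.ball (p i) (ε * R)
    · obtain ⟨i, hi⟩ := hyB
      exact (hΦB i (Finset.mem_univ i) hi).trans (rescale_eq_self hε hid (hy i))
    · exact hΦid y fun i _ h => hyB ⟨i, h⟩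

namespace IsSuperposition

variable {ι : Type*} {φ Φ : Rn n → Rn n} {p : ι → Rn n} {ε R : ℝ}

theorem tsupport_subset (h : IsSuperposition φ p ε R Φ) :
    tsupport (fun x => Φ x - x) ⊆ ⋃ i, Metric.ball (p i) (ε * R) := by
  intro x hx
  rcases h x with ⟨i, hi, -⟩ | ⟨-, h2⟩
  · exact mem_iUnion.2 ⟨i, hi⟩
  · refine absurd hx (notMem_tsupport_iff_eventuallyEq.2 ?_)
    filter_upwards [h2] with y hy
    simp [hy]

theorem norm_sub_le (h : IsSuperposition φ p ε R Φ) (hε : 0 < ε) (hR : 0 < R)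
    (hmaps : MapsTo φ (Metric.ball 0 R) (Metric.ball 0 R)) (x : Rn n) :
    ‖Φ x - x‖ ≤ 2 * (ε * R) := by
  rcases h x with ⟨i, hi, h1⟩ | ⟨-, h2⟩
  · have := mapsTo_rescale hε hmaps (p i) hi
    rw [← h1.self_of_nhds] at this
    rw [Metric.mem_ball] at this hi
    rw [← dist_eq_norm]
    linarith [dist_triangle_right (Φ x) x (p i)]
  · rw [h2.self_of_nhds, id, sub_self, norm_zero]
    positivity

theorem norm_fderiv_sub_le (h : IsSuperposition φ p ε R Φ) (hε : 0 < ε)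
    (hφ : Differentiable ℝ φ) {C : ℝ} (hC0 : 0 ≤ C)
    (hC : ∀ y, ‖fderiv ℝ φ y - ContinuousLinearMap.id ℝ (Rn n)‖ ≤ C) (x : Rn n) :
    ‖fderiv ℝ Φ x - ContinuousLinearMap.id ℝ (Rn n)‖ ≤ C := by
  rcases h x with ⟨i, -, h1⟩ | ⟨-, h2⟩
  · rw [h1.fderiv_eq, fderiv_rescale hφ _ hε]
    exact hC _
  · rw [h2.fderiv_eq, fderiv_id, sub_self, norm_zero]
    exact hC0

end IsSuperposition

/-! ### Lattices of disjoint balls -/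

/-- Some `m ^ n` disjoint balls of radius `δ / (2 * m)`, centred at lattice points of spacing
`δ / m`, lie in a ball about `x₀` whose radius does not depend on `m`. -/
theorem exists_lattice (x₀ : Rn n) {δ : ℝ} (hδ : 0 < δ) {m : ℕ} (hm : 0 < m) :
    ∃ p : (Fin n → Fin m) → Rn n,
      Pairwise (Function.onFun Disjoint fun k => Metric.ball (p k) (δ / (2 * m))) ∧
      ∀ k, Metric.ball (p k) (δ / (2 * m)) ⊆ Metric.ball x₀ (δ * (n + 1)) := by
  have hm' : (0 : ℝ) < m := by exact_mod_cast hm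
  have hm1 : (1 : ℝ) ≤ m := by exact_mod_cast hm
  refine ⟨fun k => x₀ + (δ / m) • WithLp.toLp 2 fun i => ((k i : ℕ) : ℝ), fun k l hkl => ?_,
    fun k => ?_⟩
  · refine Metric.ball_disjoint_ball ?_
    obtain ⟨i, hi⟩ := Function.ne_iff.1 hkl
    have h1 : (1 : ℝ) ≤ |((k i : ℕ) : ℝ) - ((l i : ℕ) : ℝ)| := by
      have : ((k i : ℕ) : ℤ) - ((l i : ℕ) : ℤ) ≠ 0 := by
        rw [sub_ne_zero]; exact_mod_cast fun h => hi (Fin.ext h)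
      exact_mod_cast Int.one_le_abs this
    have h2 := PiLp.norm_apply_le (p := 2) ((WithLp.toLp 2 fun i => ((k i : ℕ) : ℝ)) -
      WithLp.toLp 2 fun i => ((l i : ℕ) : ℝ)) i
    rw [dist_add_left, dist_eq_norm, ← smul_sub, norm_smul, Real.norm_of_nonneg (by positivity)]
    calc δ / (2 * m) + δ / (2 * m) = δ / m * 1 := by field_simp; norm_num
      _ ≤ _ := by
        gcongr
        exact h1.trans (by simpa using h2)
  · refine Metric.ball_subset_ball' ?_
    rw [dist_eq_norm, add_sub_cancel_left, norm_smul, Real.norm_of_nonneg (by positivity)]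
    have h1 : ‖(WithLp.toLp 2 fun i => ((k i : ℕ) : ℝ) : Rn n)‖ ≤ m * n := by
      rw [← (EuclideanSpace.basisFun (Fin n) ℝ).sum_repr
        (WithLp.toLp 2 fun i => ((k i : ℕ) : ℝ))]
      refine (norm_sum_le _ _).trans ?_
      refine (Finset.sum_le_card_nsmul _ _ (m : ℝ) fun i _ => ?_).trans ?_
      · simp [norm_smul, (k i).2.le]
      · simp [mul_comm]
    -- Crude bounds: `1 / (2 * m) ≤ 1`, and the Euclidean norm is at most the sum of coordinates.
    calc δ / (2 * m) + δ / m * _ ≤ δ / 1 + δ / m * (m * n) := by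
          gcongr; linarith
      _ = δ * (n + 1) := by field_simp; ring

/-! ### Jets and continuity of densities -/

namespace Admissible
variable {G : Set (Rn n → Rn n)}

theorem fderiv_mem_jet (hG : Admissible G) {φ : Rn n → Rn n} (hφ : φ ∈ G) (x : Rn n) :
    fderiv ℝ φ x ∈ jet G :=
  hG.jetAt_eq_jet x ▸ ⟨φ, hφ, rfl⟩

theorem comp_mem_jet (hG : Admissible G) {F F' : Mat n} (hF : F ∈ jet G) (hF' : F' ∈ jet G) :
    F ∘L F' ∈ jet G := by
  obtain ⟨φ, hφ, rfl⟩ := hF'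
  rw [← hG.jetAt_eq_jet (φ 0)] at hF
  obtain ⟨ψ, hψ, rfl⟩ := hF
  exact ⟨ψ ∘ φ, hG.comp_mem ψ hψ φ hφ,
    fderiv_comp _ ((hG.contDiff ψ hψ).differentiable one_ne_zero _)
    ((hG.contDiff φ hφ).differentiable one_ne_zero _)⟩

variable {W: Rn n → Rn n → Mat n → ℝ}

theorem continuous_density (hG : Admissible G)
    (hW : ContinuousOn (fun p : Rn n × Rn n × Mat n => W p.1 p.2.1 p.2.2)
      (Set.univ ×ˢ Set.univ ×ˢ jet G)) {u : Rn n → Rn n} (hu : u ∈ G) :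
    Continuous fun x => W x (u x) (fderiv ℝ u x) := by
  have h1 := (hG.contDiff u hu).continuous
  have h2 := (hG.contDiff u hu).continuous_fderiv one_ne_zero
  exact hW.comp_continuous (continuous_id.prodMk (h1.prodMk h2))
    fun x => ⟨mem_univ _, mem_univ _, hG.fderiv_mem_jet hu x⟩

theorem continuous_density_comp (hG : Admissible G)
    (hW : ContinuousOn (fun p : Rn n × Rn n × Mat n => W p.1 p.2.1 p.2.2)
      (Set.univ ×ˢ Set.univ ×ˢ jet G)) {φ ψ : Rn n → Rn n} (hφ : φ ∈ G) (hψ : ψ ∈ G) :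
    Continuous fun q : (Rn n × Rn n) × Rn n =>
      W q.1.1 (ψ q.1.2) (fderiv ℝ ψ q.1.2 ∘L fderiv ℝ φ q.2) := by
  have h1 := (hG.contDiff ψ hψ).continuous
  have h2 := (hG.contDiff ψ hψ).continuous_fderiv one_ne_zero
  have h3 := (hG.contDiff φ hφ).continuous_fderiv one_ne_zero
  refine hW.comp_continuous ((continuous_fst.comp continuous_fst).prodMk
    ((h1.comp (continuous_snd.comp continuous_fst)).prodMk
      ((h2.comp (continuous_snd.comp continuous_fst)).clm_comp (h3.comp continuous_snd))))
    fun x => ⟨mem_univ _, mem_univ _,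
      hG.comp_mem_jet (hG.fderiv_mem_jet hψ _) (hG.fderiv_mem_jet hφ _)⟩

/-- Near `x₀` the perturbed density differs from the unperturbed one by at most its excess at `x₀`
plus `η`. The point `x` and the argument `z` of `ψ` vary independently, because `z` is to be the
image of `x` under a superposition of small copies of `φ`. -/
theorem exists_oscillation_bound (hG : Admissible G)
    (hW : ContinuousOn (fun p : Rn n × Rn n × Mat n => W p.1 p.2.1 p.2.2)
      (Set.univ ×ˢ Set.univ ×ˢ jet G)) {φ ψ : Rn n → Rn n} (hφ : φ ∈ G) (hψ : ψ ∈ G)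
    (x₀ : Rn n) (R : ℝ) {η : ℝ} (hη : 0 < η) :
    ∃ ρ > 0, ∀ x ∈ Metric.ball x₀ ρ, ∀ z ∈ Metric.ball x₀ ρ, ∀ y ∈ Metric.ball 0 R,
      W x (ψ z) (fderiv ℝ ψ z ∘L fderiv ℝ φ y) - W x (ψ x) (fderiv ℝ ψ x) ≤
        W x₀ (ψ x₀) (fderiv ℝ ψ x₀ ∘L fderiv ℝ φ y) - W x₀ (ψ x₀) (fderiv ℝ ψ x₀) + η := by
  have hc := hG.continuous_density_comp hW hφ hψ
  have hd := hG.continuous_density hW hψ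
  have key : ∀ᶠ q : Rn n × Rn n in 𝓝 (x₀, x₀), ∀ y ∈ Metric.closedBall (0 : Rn n) R,
      W q.1 (ψ q.2) (fderiv ℝ ψ q.2 ∘L fderiv ℝ φ y) - W q.1 (ψ q.1) (fderiv ℝ ψ q.1) <
        W x₀ (ψ x₀) (fderiv ℝ ψ x₀ ∘L fderiv ℝ φ y) - W x₀ (ψ x₀) (fderiv ℝ ψ x₀) + η := by
    refine (isCompact_closedBall (0 : Rn n) R).eventually_forall_of_forall_eventually
      fun y _ => ?_
    refine ContinuousAt.eventually_lt ?_ ?_ (lt_add_of_pos_right _ hη)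
    · exact (hc.sub (hd.comp (continuous_fst.comp continuous_fst))).continuousAt
    · have : Continuous fun q : (Rn n × Rn n) × Rn n =>
          (((x₀, x₀), q.2) : (Rn n × Rn n) × Rn n) :=
        continuous_const.prodMk continuous_snd
      exact (((hc.comp this).sub continuous_const).add continuous_const).continuousAt
  rw [nhds_prod_eq] at key
  obtain ⟨ρ, hρ, h⟩ := (Metric.nhds_basis_ball.prod_self.eventually_iff).1 key
  exact ⟨ρ, hρ, fun x hx z hz y hy =>
    (h (mk_mem_prod hx hz) y (Metric.ball_subset_closedBall hy)).le⟩

end Admissible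

/-! ### The excess of a perturbation -/

/-- The change of `W(x₀, y₀, ·)` at the gradient `F` caused by the perturbation `φ`, as a function
of the point: `W(x₀, y₀, F ∇φ(y)) - W(x₀, y₀, F)`. -/
noncomputable def excess (W : Rn n → Rn n → Mat n → ℝ) (x₀ y₀ : Rn n) (F : Mat n)
    (φ : Rn n → Rn n) (y : Rn n) : ℝ :=
  W x₀ y₀ (F ∘L fderiv ℝ φ y) - W x₀ y₀ F

theorem fderiv_eq_id_of_notMem_tsupport {φ : Rn n → Rn n} {y : Rn n}
    (hy : y ∉ tsupport fun x => φ x - x) : fderiv ℝ φ y = ContinuousLinearMap.id ℝ (Rn n) := by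
  have : φ =ᶠ[𝓝 y] id := by
    filter_upwards [notMem_tsupport_iff_eventuallyEq.1 hy] with z hz
    exact sub_eq_zero.1 hz
  rw [this.fderiv_eq, fderiv_id]

theorem excess_eq_zero {W : Rn n → Rn n → Mat n → ℝ} {x₀ y₀ : Rn n} {F : Mat n}
    {φ : Rn n → Rn n} {y : Rn n} (hy : y ∉ tsupport fun x => φ x - x) :
    excess W x₀ y₀ F φ y = 0 := by
  rw [excess, fderiv_eq_id_of_notMem_tsupport hy, ContinuousLinearMap.comp_id, sub_self]

theorem integral_comp_inv_smul_sub (q : Rn n → ℝ) (p : Rn n) {ε : ℝ} (hε : 0 < ε) :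
    ∫ x, q (ε⁻¹ • (x - p)) = ε ^ n * ∫ y, q y := by
  rw [integral_sub_right_eq_self (fun x => q (ε⁻¹ • x)) p,
    Measure.integral_comp_inv_smul, finrank_euclideanSpace_fin, smul_eq_mul,
    abs_of_pos (pow_pos hε n)]

namespace Admissible

variable {G : Set (Rn n → Rn n)} {W : Rn n → Rn n → Mat n → ℝ}

theorem continuous_excess (hG : Admissible G)
    (hW : ContinuousOn (fun p : Rn n × Rn n × Mat n => W p.1 p.2.1 p.2.2)
      (Set.univ ×ˢ Set.univ ×ˢ jet G)) {φ : Rn n → Rn n} (hφ : φ ∈ G) (x₀ y₀ : Rn n)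
    {F : Mat n} (hF : F ∈ jet G) : Continuous (excess W x₀ y₀ F φ) := by
  have h1 := (hG.contDiff φ hφ).continuous_fderiv one_ne_zero
  refine Continuous.sub ?_ continuous_const
  exact hW.comp_continuous (continuous_const.prodMk (continuous_const.prodMk
    (continuous_const.clm_comp h1)))
    fun y => ⟨mem_univ _, mem_univ _, hG.comp_mem_jet hF (hG.fderiv_mem_jet hφ y)⟩

theorem integrableOn_density (hG : Admissible G)
    (hW : ContinuousOn (fun p : Rn n × Rn n × Mat n => W p.1 p.2.1 p.2.2)
      (Set.univ ×ˢ Set.univ ×ˢ jet G)) {Ω : Set (Rn n)} (hΩb : Bornology.IsBounded Ω)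
    {u : Rn n → Rn n} (hu : u ∈ G) :
    IntegrableOn (fun x => W x (u x) (fderiv ℝ u x)) Ω :=
  ((hG.continuous_density hW hu).continuousOn.integrableOn_compact
    hΩb.isCompact_closure).mono_set subset_closure

/-! ### Energy of superpositions -/

/-- Composing `ψ` with a superpositionof copies of `φ` within a small ball around `x₀` raises the
energy, up to an error proportional to the volume of the copies, by at most the total rescaled
excess of `φ` at `x₀`. -/
theorem energy_comp_le (hG : Admissible G)
    (hW : ContinuousOn (fun p : Rn n × Rn n × Mat n => W p.1 p.2.1 p.2.2)
      (Set.univ ×ˢ Set.univ ×ˢ jet G)) {Ω : Set (Rn n)}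
    (hΩb : Bornology.IsBounded Ω) {φ ψ Φ : Rn n → Rn n} (hφ : φ ∈ G) (hψ : ψ ∈ G) (hΦG : Φ ∈ G)
    {ι : Type*} [Fintype ι] {p : ι → Rn n} {ε R : ℝ} (hε : 0 < ε)
    (hp : Pairwise (Function.onFun Disjoint fun i => Metric.ball (p i) (ε * R)))
    (hΦ : IsSuperposition φ p ε R Φ)
    (hmaps : MapsTo φ (Metric.ball 0 R) (Metric.ball 0 R))
    (hsupp : tsupport (fun x => φ x - x) ⊆ Metric.ball 0 R)
    {x₀ : Rn n} {ρ η : ℝ}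
    (hosc : ∀ x ∈ Metric.ball x₀ ρ, ∀ z ∈ Metric.ball x₀ ρ, ∀ y ∈ Metric.ball 0 R,
      W x (ψ z) (fderiv ℝ ψ z ∘L fderiv ℝ φ y) - W x (ψ x) (fderiv ℝ ψ x) ≤
        excess W x₀ (ψ x₀) (fderiv ℝ ψ x₀) φ y + η)
    (hpΩ : ∀ i, Metric.ball (p i) (ε * R) ⊆ Ω)
    (hpρ : ∀ i, Metric.ball (p i) (ε * R) ⊆ Metric.ball x₀ ρ) :
    energy W Ω (ψ ∘ Φ) ≤ energy W Ω ψ + Fintype.card ι * ε ^ n *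
      ((∫ y, excess W x₀ (ψ x₀) (fderiv ℝ ψ x₀) φ y) +
        η * volume.real (Metric.ball (0 : Rn n) R)) := by
  set d := excess W x₀ (ψ x₀) (fderiv ℝ ψ x₀) φ with hd
  set q : Rn n → ℝ := fun y => d y + (Metric.ball (0 : Rn n) R).indicator (fun _ => η) y with hq
  have hd0 : ∀ y ∉ Metric.ball (0 : Rn n) R, d y = 0 := fun y hy =>
    excess_eq_zero fun h => hy (hsupp h)
  have hq0 : ∀ y ∉ Metric.ball (0 : Rn n) R, q y = 0 := fun y hy => by
    simp [hq, hd0 y hy, hy]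
  have hdi : Integrable d := by
    refine (hG.continuous_excess hW hφ x₀ (ψ x₀)
      (hG.fderiv_mem_jet hψ x₀)).integrable_of_hasCompactSupport
      (HasCompactSupport.intro (isCompact_closedBall (0 : Rn n) R) fun y hy => ?_)
    exact hd0 y fun h => hy (Metric.ball_subset_closedBall h)
  have hηi : Integrable ((Metric.ball (0 : Rn n) R).indicator fun _ => η) :=
    (integrable_indicator_iff measurableSet_ball).2
      (integrableOn_const measure_ball_lt_top.ne)
  have hqi : Integrable q := hdi.add hηi
  have hqint : ∫ y, q y = (∫ y, d y) + η * volume.real (Metric.ball (0 : Rn n) R) := by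
    rw [hq, integral_add hdi hηi, integral_indicator measurableSet_ball, setIntegral_const,
      smul_eq_mul, mul_comm η]
  have hqpi : ∀ i, Integrable fun x => q (ε⁻¹ • (x - p i)) := fun i =>
    (hqi.comp_smul (inv_ne_zero hε.ne')).comp_sub_right (p i)
  have hball : ∀ i x, ε⁻¹ • (x - p i) ∈ Metric.ball (0 : Rn n) R ↔
      x ∈ Metric.ball (p i) (ε * R) := fun i x => by
    rw [mem_ball_zero_iff, norm_inv_smul_sub_lt_iff hε]
  -- The increase of the density is dominated pointwise by the sum of the rescaled copies of `q`.
  have hpt : ∀ x, W x ((ψ ∘ Φ) x) (fderiv ℝ (ψ ∘ Φ) x) - W x (ψ x) (fderiv ℝ ψ x) ≤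
      ∑ i, q (ε⁻¹ • (x - p i)) := by
    intro x
    rcases hΦ x with ⟨i, hi, hev⟩ | ⟨hx, hev⟩
    · have hΦx : Φ x ∈ Metric.ball (p i) (ε * R) :=
        hev.self_of_nhds ▸ mapsTo_rescale hε hmaps (p i) hi
      have hy := (hball i x).2 hi
      -- By disjointness only the term of the ball containing `x` is nonzero.
      rw [Finset.sum_eq_single i
        (fun j _ hj => hq0 _ fun h => (hp hj).notMem_of_mem_left ((hball j x).1 h) hi)
        (fun h => absurd (Finset.mem_univ i) h)]
      rw [fderiv_comp x ((hG.contDiff ψ hψ).differentiable one_ne_zero _)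
        ((hG.contDiff Φ hΦG).differentiable one_ne_zero _), hev.fderiv_eq,
        fderiv_rescale ((hG.contDiff φ hφ).differentiable one_ne_zero) _ hε, hq]
      simp only [indicator_of_mem hy]
      exact hosc x (hpρ i hi) _ (hpρ i hΦx) _ hy
    · have hev' : ψ ∘ Φ =ᶠ[𝓝 x] ψ := by
        filter_upwards [hev] with z hz
        simp [hz]
      rw [hev'.fderiv_eq, hev'.self_of_nhds, sub_self,
        Finset.sum_eq_zero fun i _ => hq0 _ fun h => hx i ((hball i x).1 h)]
  have hi1 := hG.integrableOn_density hW hΩb (hG.comp_mem ψ hψ Φ hΦG)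
  have hi2 := hG.integrableOn_density hW hΩb hψ
  have hdiff : energy W Ω (ψ ∘ Φ) - energy W Ω ψ ≤ ∑ i, ∫ x, q (ε⁻¹ • (x - p i)) := by
    rw [energy, energy, ← integral_sub hi1 hi2, ← integral_finsetSum _ fun i _ => hqpi i,
      ← setIntegral_eq_integral_of_forall_compl_eq_zero (s := Ω)
        (f := fun x => ∑ i, q (ε⁻¹ • (x - p i)))]
    · exact integral_mono (hi1.sub hi2)
        (integrable_finsetSum _ fun i _ => hqpi i).integrableOn hpt
    · exact fun x hx => Finset.sum_eq_zero fun i _ => hq0 _ fun h => hx (hpΩ i ((hball i x).1 h))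
  simp only [integral_comp_inv_smul_sub q _ hε, hqint, Finset.sum_const, Finset.card_univ,
    nsmul_eq_mul] at hdiff
  linarith

/-- Superposing ever finer copies of `φ`, placed on the points of a lattice near `x₀`, gives a
sequence converging weak* to the identity whose effect on the energy is a fixed positive multiple of
the excess of `φ` at `x₀`, up to a small error. Refining the lattice keeps the total volume of the
copies constant. -/
theorem exists_seq_superposition (hG : Admissible G)
    (hW : ContinuousOn (fun p : Rn n × Rn n × Mat n => W p.1 p.2.1 p.2.2)
      (Set.univ ×ˢ Set.univ ×ˢ jet G)) {Ω : Set (Rn n)} (hΩ : IsOpen Ω)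
    (hΩb : Bornology.IsBounded Ω) {φ ψ : Rn n → Rn n} (hφ : φ ∈ G) (hψ : ψ ∈ G)
    {R : ℝ} (hR : 0 < R) {r : ℝ} (hrR : r < R) (hid : ∀ x, r < ‖x‖ → φ x = x)
    (hmaps : MapsTo φ (Metric.ball 0 R) (Metric.ball 0 R))
    {x₀ : Rn n} (hx₀ : x₀ ∈ Ω) {η : ℝ} (hη : 0 < η) :
    ∃ κ > 0, ∃ Φ : ℕ → Rn n → Rn n, (∀ h, Φ h ∈ supportedIn G Ω) ∧ WeakStarTendsto Ω Φ id ∧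
      ∀ h, energy W Ω (ψ ∘ Φ h) ≤ energy W Ω ψ + κ *
        ((∫ y, excess W x₀ (ψ x₀) (fderiv ℝ ψ x₀) φ y) +
          η * volume.real (Metric.ball (0 : Rn n) R)) := by
  have hφd := (hG.contDiff φ hφ).differentiable one_ne_zero
  have hsupp : tsupport (fun x => φ x - x) ⊆ Metric.ball 0 R := by
    refine (closure_minimal (fun x hx => ?_) Metric.isClosed_closedBall).trans
      (Metric.closedBall_subset_ball hrR)
    by_contra h
    rw [mem_closedBall_zero_iff, not_le] at h
    exact hx (by simp [hid x h])
  obtain ⟨ρ₁, hρ₁, hosc⟩ := hG.exists_oscillation_bound hW hφ hψ x₀ R hη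
  obtain ⟨ρ₂, hρ₂, hρΩ⟩ := Metric.isOpen_iff.1 hΩ x₀ hx₀
  obtain ⟨C, hC⟩ := (isCompact_closedBall (0 : Rn n) R).exists_bound_of_continuousOn
    (((hG.contDiff φ hφ).continuous_fderiv one_ne_zero).sub
      (continuous_const (y := ContinuousLinearMap.id ℝ (Rn n)))).continuousOn
  have hC0 : 0 ≤ C := (norm_nonneg _).trans (hC 0 (Metric.mem_closedBall_self hR.le))
  have hC' : ∀ y, ‖fderiv ℝ φ y - ContinuousLinearMap.id ℝ (Rn n)‖ ≤ C := by
    intro y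
    by_cases hy : y ∈ Metric.closedBall (0 : Rn n) R
    · exact hC y hy
    · rw [fderiv_eq_id_of_notMem_tsupport fun h => hy (Metric.ball_subset_closedBall (hsupp h)),
        sub_self, norm_zero]
      exact hC0
  set δ := min ρ₁ ρ₂ / (n + 1) with hδdef
  have hδ : 0 < δ := by positivity
  have hδρ : δ * (n + 1) = min ρ₁ ρ₂ := by rw [hδdef]; field_simp
  have hstep : ∀ h : ℕ, ∃ Φ ∈ supportedIn G Ω,
      (∀ x, ‖Φ x - x‖ ≤ δ / (h + 1 : ℕ)) ∧
      (∀ x, ‖fderiv ℝ Φ x - ContinuousLinearMap.id ℝ (Rn n)‖ ≤ C) ∧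
      energy W Ω (ψ ∘ Φ) ≤ energy W Ω ψ + (δ / (2 * R)) ^ n *
        ((∫ y, excess W x₀ (ψ x₀) (fderiv ℝ ψ x₀) φ y) +
          η * volume.real (Metric.ball (0 : Rn n) R)) := by
    intro h
    obtain ⟨p, hp, hpsub⟩ := exists_lattice (n := n) x₀ hδ h.succ_pos
    set m : ℕ := h + 1 with hm
    have hm0 : (0 : ℝ) < m := by positivity
    set ε := δ / (2 * m) / R with hεdef
    have hε : 0 < ε := by positivity
    have hεR : δ / (2 * m) = ε * R := by rw [hεdef]; field_simp
    change Pairwise (Function.onFun Disjoint fun k => Metric.ball (p k) (δ / (2 * m))) at hp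
    change ∀ k, Metric.ball (p k) (δ / (2 * m)) ⊆ _ at hpsub
    rw [hεR] at hp hpsub
    rw [hδρ] at hpsub
    have hpΩ : ∀ k, Metric.ball (p k) (ε * R) ⊆ Ω := fun k =>
      (hpsub k).trans ((Metric.ball_subset_ball (min_le_right _ _)).trans hρΩ)
    have hpρ : ∀ k, Metric.ball (p k) (ε * R) ⊆ Metric.ball x₀ ρ₁ := fun k =>
      (hpsub k).trans (Metric.ball_subset_ball (min_le_left _ _))
    obtain ⟨Φ, hΦG, hΦ⟩ := hG.exists_isSuperposition hφ hrR hid hmaps hε hp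
    refine ⟨Φ, ⟨hΦG, hG.hasCompactSupport Φ hΦG, hΦ.tsupport_subset.trans (iUnion_subset hpΩ)⟩,
      fun x => ?_, hΦ.norm_fderiv_sub_le hε hφd hC0 hC', ?_⟩
    · refine (hΦ.norm_sub_le hε hR hmaps x).trans_eq ?_
      rw [← hεR]
      field_simp
    · -- The copies keep a constant total volume as `m` grows.
      have hcard : (Fintype.card (Fin n → Fin m) : ℝ) * ε ^ n = (δ / (2 * R)) ^ n := by
        rw [Fintype.card_fun, Fintype.card_fin, Fintype.card_fin, Nat.cast_pow, ← mul_pow]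
        congr 1
        rw [hεdef]
        field_simp
      rw [← hcard]
      exact hG.energy_comp_le hW hΩb hφ hψ hΦG hε hp hΦ hmaps hsupp hosc hpΩ hpρ
  choose Φ hΦΩ hΦn hΦd hΦe using hstep
  refine ⟨(δ / (2 * R)) ^ n, by positivity, Φ, hΦΩ, ?_, hΦe⟩
  refine weakStarTendsto_id hΩ hΩb (fun h => hG.contDiff _ (hΦΩ h).1) (fun h => (hΦΩ h).2.1)
    hΦn ?_ hΦd
  exact (tendsto_const_div_atTop_nhds_zero_nat δ).comp (tendsto_add_atTop_nat 1)

/-- The energy inequality along the sequence of superpositions forces the integral of the excess of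
`φ` to be nonnegative up to an arbitrarily small error. -/
theorem leftLowerInvariantAt_of_lsc (hG : Admissible G)
    (hW : ContinuousOn (fun p : Rn n × Rn n × Mat n => W p.1 p.2.1 p.2.2)
      (Set.univ ×ˢ Set.univ ×ˢ jet G)) {Ω : Set (Rn n)} (hΩ : IsOpen Ω)
    (hΩb : Bornology.IsBounded Ω) {ψ : Rn n → Rn n} (hψ : ψ ∈ G)
    (hlsc : ∀ φ : ℕ → Rn n → Rn n, (∀ h, φ h ∈ supportedIn G Ω) → WeakStarTendsto Ω φ id →
      ((energy W Ω ψ : ℝ) : EReal) ≤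
        liminf (fun h => ((energy W Ω (ψ ∘ φ h) : ℝ) : EReal)) atTop)
    {x₀ : Rn n} (hx₀ : x₀ ∈ Ω) : LeftLowerInvariantAt G W x₀ (ψ x₀) (fderiv ℝ ψ x₀) := by
  intro E hE hEb φ ⟨hφ, _, hφE⟩
  have hF := hG.fderiv_mem_jet hψ x₀
  obtain ⟨r, R, hr, hrR, hid, hmaps⟩ := hG.exists_radius hφ
  have hmain : 0 ≤ ∫ y, excess W x₀ (ψ x₀) (fderiv ℝ ψ x₀) φ y := by
    set V := volume.real (Metric.ball (0 : Rn n) R) with hV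
    have hV0 : 0 ≤ V := measureReal_nonneg
    refine le_of_forall_pos_le_add fun θ hθ => ?_
    obtain ⟨κ, hκ, Φ, hΦ, hΦw, hΦe⟩ := hG.exists_seq_superposition hW hΩ hΩb hφ hψ
      (hr.trans hrR) hrR hid hmaps hx₀ (η := θ / (V + 1)) (by positivity)
    have hle := (hlsc Φ hΦ hΦw).trans (liminf_le_of_le
      (h := fun b hb => (hb.exists.choose_spec).trans (EReal.coe_le_coe_iff.2 (hΦe _))))
    have h0 := nonneg_of_mul_nonneg_right
      (le_add_iff_nonneg_right _ |>.1 (EReal.coe_le_coe_iff.1 hle)) hκ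
    have : θ / (V + 1) * V ≤ θ := by
      rw [div_mul_eq_mul_div, div_le_iff₀ (by positivity)]
      nlinarith
    linarith
  rw [← setIntegral_eq_integral_of_forall_compl_eq_zero (s := E)
    fun y hy => excess_eq_zero fun h => hy (hφE h)] at hmain
  have hd : IntegrableOn (excess W x₀ (ψ x₀) (fderiv ℝ ψ x₀) φ) E :=
    ((hG.continuous_excess hW hφ x₀ (ψ x₀) hF).continuousOn.integrableOn_compact
      hEb.isCompact_closure).mono_set subset_closure
  have hc : IntegrableOn (fun _ : Rn n => W x₀ (ψ x₀) (fderiv ℝ ψ x₀)) E :=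
    integrableOn_const hEb.measure_lt_top.ne
  calc volume.real E * W x₀ (ψ x₀) (fderiv ℝ ψ x₀)
      = ∫ _ in E, W x₀ (ψ x₀) (fderiv ℝ ψ x₀) := by rw [setIntegral_const, smul_eq_mul]
    _ ≤ (∫ y in E, excess W x₀ (ψ x₀) (fderiv ℝ ψ x₀) φ y) +
        ∫ _ in E, W x₀ (ψ x₀) (fderiv ℝ ψ x₀) := le_add_of_nonneg_left hmain
    _ = ∫ y in E, W x₀ (ψ x₀) (fderiv ℝ ψ x₀ ∘L fderiv ℝ φ y) := by
        rw [← integral_add hd hc]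
        simp only [excess, sub_add_cancel]

end Admissible

end GroupInvariance

open GroupInvariance in
theorem theorem4p2 (n : ℕ) (G : Set (Rn n → Rn n)) (hG : Admissible G)
    (Ω : Set (Rn n)) (hΩ : IsOpen Ω) (hΩb : Bornology.IsBounded Ω)
    (W : Rn n → Rn n → Mat n → ℝ)
    (hW : ContinuousOn (fun p : Rn n × Rn n × Mat n => W p.1 p.2.1 p.2.2)
      (Set.univ ×ˢ Set.univ ×ˢ jet G))
    (hlsc : ∀ ψ ∈ G, ∀ φ : ℕ → Rn n → Rn n, (∀ h, φ h ∈ supportedIn G Ω) →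
      WeakStarTendsto Ω φ id →
      ((energy W Ω ψ : ℝ) : EReal) ≤
        Filter.liminf (fun h => ((energy W Ω (ψ ∘ φ h) : ℝ) : EReal)) Filter.atTop) :
    (∀ ψ ∈ G, ∀ x ∈ Ω, LeftLowerInvariantAt G W x (ψ x) (fderiv ℝ ψ x)) ∧
    ((∀ x y y' : Rn n, ∀ F ∈ jet G, W x y F = W x y' F) →
      ∀ x ∈ Ω, ∀ y : Rn n, ∀ F ∈ jet G, LeftLowerInvariantAt G W x y F) := by
  have hinv : ∀ ψ ∈ G, ∀ x ∈ Ω, LeftLowerInvariantAt G W x (ψ x) (fderiv ℝ ψ x) :=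
    fun ψ hψ x hx => hG.leftLowerInvariantAt_of_lsc hW hΩ hΩb hψ (hlsc ψ hψ) hx
  refine ⟨hinv, fun hind x hx y F hF E hE hEb φ hφ => ?_⟩
  -- Every `F ∈ J(G)` is the gradient at `x` of some `ψ ∈ G`; then `ψ x` may be replaced by `y`.
  obtain ⟨ψ, hψ, rfl⟩ := hG.jetAt_eq_jet x ▸ hF
  have h := hinv ψ hψ x hx E hE hEb φ hφ
  simp only [hind x (ψ x) y _ hF] at h
  simpa only [fun z => hind x (ψ x) y _ (hG.comp_mem_jet hF (hG.fderiv_mem_jet hφ.1 z))] using h
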